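/- For $\mu,\nu\in\mathbb{C}$ and $z\in\mathbb{C}\setminus(-\infty,1]$ let $$P_\nu^\mu(z)=\frac{1}{\Gamma(1-\mu)}\left(\frac{z+1}{z-1}\right)^{\mu/2}{}_2F_1\left(-\nu,\nu+1;1-\mu;\frac{1-z}{2}\right)$$ be the associated Legendre function of the first kind (Hobson's normalization). Here $\frac{1}{\Gamma(c)}\,{}_2F_1(a,b;c;w)$ denotes the analytic continuation from the unit disc to $\mathbb{C}\setminus[1,\infty)$ of $\sum_{k\ge0}\frac{(a)_k(b)_k}{\Gamma(c+k)\,k!}w^k$, with $1/\Gamma=0$ at the poles of $\Gamma$. All phases are fixed by $-\pi<\arg(z\pm1)<\pi$; thus $\left(\frac{z\pm1}{z\mp1}\right)^{s}=(z\pm1)^{s}(z\mp1)^{-s}$ and $\left(\frac{z^2-1}{4}\right)^{s}=\left(\frac{z-1}{2}\right)^{s}\left(\frac{z+1}{2}\right)^{s}$ with principal powers, and $\ln$ is the principal logarithm. Let $\psi=\Gamma'/\Gamma$ be the digamma function. Then for all integers $0\le m\le n$ and all $z\in\mathbb{C}\setminus(-\infty,1]$ the function $\nu\mapsto P_\nu^m(z)$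 of the complex variable $\nu$ is differentiable at $\nu=n$, and $$\begin{aligned}\left.\frac{\partial P_\nu^m(z)}{\partial\nu}\right|_{\nu=n}={}&P_n^m(z)\ln\frac{z+1}{2}+\left[\psi(n+m+1)-2\psi(n+1)-\psi(n-m+1)\right]P_n^m(z)\\&+\left(\frac{z^2-1}{4}\right)^{m/2}\sum_{k=0}^{n-m}\frac{(k+n+m)!\,\psi(k+m+1)}{k!\,(k+m)!\,(n-m-k)!}\left(\frac{z-1}{2}\right)^k\\&+\frac{(n+m)!}{(n-m)!}\left(\frac{z-1}{z+1}\right)^{m/2}\sum_{k=0}^{n}\frac{(k+n)!}{k!\,(k+m)!\,(n-k)!}\left[2\psi(k+n+1)-\psi(k+m+1)\right]\left(\frac{z-1}{2}\right)^k.\end{aligned}$$ -/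

import Mathlib

open Complex MeasureTheory Set Metric

/-- The complex plane cut along `[1, ∞)`. -/
def hypCutPlane : Set ℂ := {w | 1 - w ∈ slitPlane}

theorem isOpen_hypCutPlane : IsOpen hypCutPlane :=
  isOpen_slitPlane.preimage (by fun_prop : Continuous fun w : ℂ => 1 - w)

theorem ball_subset_hypCutPlane : ball (0 : ℂ) 1 ⊆ hypCutPlane := by
  intro w hw
  have := mem_slitPlane_of_norm_lt_one (z := -w) (by simpa using hw)
  simpa [hypCutPlane, sub_eq_add_neg] using this

theorem one_sub_mul_mem_slitPlane {w : ℂ} (hw : w ∈ hypCutPlane) {t : ℝ} (h0 : 0 ≤ t)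
    (h1 : t ≤ 1) : 1 - w * t ∈ slitPlane := by
  have := starConvex_one_slitPlane hw (sub_nonneg.2 h1) h0 (by ring)
  convert this using 1
  simp only [real_smul, ofReal_sub, ofReal_one]
  ring

/-- `F` is a single-valued analytic continuation to `ℂ \ [1, ∞)` of the regularized Gauss
hypergeometric series `∑ₖ (a)ₖ (b)ₖ wᵏ / (Γ(c + k) k!)`. -/
def IsHypContinuation (a b c : ℂ) (F : ℂ → ℂ) : Prop :=
  DifferentiableOn ℂ F hypCutPlane ∧ EqOn F (regularizedGaussHGFun a b c) (ball 0 1)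

theorem IsHypContinuation.eqOn {a b c : ℂ} {F G : ℂ → ℂ} (hF : IsHypContinuation a b c F)
    (hG : IsHypContinuation a b c G) : EqOn F G hypCutPlane := by
  have hstar : StarConvex ℝ 0 hypCutPlane := by
    intro w hw s t hs ht hst
    have := one_sub_mul_mem_slitPlane hw ht (by linarith)
    simpa [hypCutPlane, mul_comm] using this
  have h0 : (0 : ℂ) ∈ hypCutPlane := ball_subset_hypCutPlane (by simp)
  refine (hF.1.analyticOnNhd isOpen_hypCutPlane).eqOn_of_preconnected_of_eventuallyEq
    (hG.1.analyticOnNhd isOpen_hypCutPlane)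
    (hstar.isPathConnected h0).isConnected.isPreconnected h0 ?_
  filter_upwards [ball_mem_nhds (0 : ℂ) one_pos] with w hw
  rw [hF.2 hw, hG.2 hw]

theorem hasSum_regularizedGaussHGFun (a b c : ℂ) {w : ℂ} (hw : w ∈ ball (0 : ℂ) 1) :
    HasSum (fun k : ℕ => (ascPochhammer ℂ k).eval a * (ascPochhammer ℂ k).eval b /
      (k.factorial * Gamma (c + k)) * w ^ k) (regularizedGaussHGFun a b c w) := by
  have hr := radius_regularizedGaussHGFunSeries_ge_one a b c
  have h := (regularizedGaussHGFunSeries a b c).hasSum (x := w) (by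
    refine eball_subset_eball hr ?_
    rw [← ENNReal.ofReal_one, eball_ofReal]
    exact hw)
  have h2 : ∀ k : ℕ, (regularizedGaussHGFunSeries a b c k fun _ => w) =
    (ascPochhammer ℂ k).eval a * (ascPochhammer ℂ k).eval b /
      (k.factorial * Gamma (c + k)) * w ^ k := by
    intro k
    rw [FormalMultilinearSeries.apply_eq_prod_smul_coeff, coeff_regularizedGaussHGFunSeries]
    simp [mul_comm]
  rw [funext h2] at h
  exact h

theorem hasSum_one_sub_cpow (a : ℂ) {y : ℂ} (hy : ‖y‖ < 1) :
    HasSum (fun k : ℕ => (ascPochhammer ℂ k).eval a / k.factorial * y ^ k) ((1 - y) ^ (-a)) := by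
  have h := (one_div_one_sub_cpow_hasFPowerSeriesOnBall_zero a).hasSum (y := y) (by
    rw [← ENNReal.ofReal_one, eball_ofReal]
    simpa using hy)
  rw [zero_add, one_div, ← cpow_neg] at h
  refine Eq.mp (congrArg (fun f : ℕ → ℂ => HasSum f _) (funext fun k => ?_)) h
  rw [FormalMultilinearSeries.ofScalars_apply_eq, smul_eq_mul]
  congr 1
  rw [Ring.choose_eq_smul, Polynomial.descPochhammer_smeval_eq_ascPochhammer,
    Polynomial.ascPochhammer_smeval_cast, Polynomial.ascPochhammer_smeval_eq_eval]
  rw [show a + (k : ℂ) - 1 - k + 1 = a by ring]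
  simp [div_eq_inv_mul]

theorem exists_isHypContinuation_of_re_lt (a : ℂ) {b c : ℂ} (hb : 0 < b.re) (hbc : b.re < c.re) :
    ∃ F, IsHypContinuation a b c F := by
  have hcb : 0 < (c - b).re := by simpa using hbc
  set K : ℝ → ℂ := fun t => (t : ℂ) ^ (b - 1) * (1 - (t : ℂ)) ^ (c - b - 1) with hK
  have hKint : IntervalIntegrable K volume 0 1 := betaIntegral_convergent hb hcb
  have hI : uIoc (0 : ℝ) 1 = Ioc 0 1 := uIoc_of_le zero_le_one
  have hpow : ∀ (s w : ℂ), w ∈ hypCutPlane →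
      ContinuousOn (fun t : ℝ => (1 - w * t) ^ s) (uIcc 0 1) := by
    intro s w hw t ht
    rw [uIcc_of_le zero_le_one] at ht
    have h1 : ContinuousAt (fun t : ℝ => 1 - w * (t : ℂ)) t := by fun_prop
    exact (h1.cpow continuousAt_const
      (one_sub_mul_mem_slitPlane hw ht.1 ht.2)).continuousWithinAt
  refine ⟨fun w => (Gamma b * Gamma (c - b))⁻¹ * ∫ t in (0 : ℝ)..1, K t * (1 - w * t) ^ (-a),
    ?_, ?_⟩
  · intro w₀ hw₀
    refine DifferentiableAt.differentiableWithinAt (DifferentiableAt.const_mul ?_ _)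
    obtain ⟨ε, hε, hball⟩ := nhds_basis_closedBall.mem_iff.1 (isOpen_hypCutPlane.mem_nhds hw₀)
    have hcomp : IsCompact (closedBall w₀ ε ×ˢ Icc (0 : ℝ) 1) :=
      (isCompact_closedBall _ _).prod isCompact_Icc
    have hcont : ContinuousOn (fun p : ℂ × ℝ => (-a) * (1 - p.1 * p.2) ^ (-a - 1) * (-(p.2 : ℂ)))
        (closedBall w₀ ε ×ˢ Icc (0 : ℝ) 1) := by
      intro p hp
      refine ContinuousAt.continuousWithinAt ?_
      have h1 : ContinuousAt (fun p : ℂ × ℝ => 1 - p.1 * (p.2 : ℂ)) p := by fun_prop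
      have h2 : ContinuousAt (fun p : ℂ × ℝ => -(p.2 : ℂ)) p := by fun_prop
      exact (continuousAt_const.mul (h1.cpow continuousAt_const
        (one_sub_mul_mem_slitPlane (hball hp.1) hp.2.1 hp.2.2))).mul h2
    obtain ⟨C, hC⟩ := hcomp.exists_bound_of_continuousOn hcont
    have key := intervalIntegral.hasDerivAt_integral_of_dominated_loc_of_deriv_le
      (μ := volume) (a := (0 : ℝ)) (b := 1) (x₀ := w₀) (s := closedBall w₀ ε)
      (F := fun w t => K t * (1 - w * t) ^ (-a))
      (F' := fun w t => K t * ((-a) * (1 - w * t) ^ (-a - 1) * (-(t : ℂ))))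
      (bound := fun t => ‖K t‖ * C)
      (closedBall_mem_nhds _ hε) ?_ ?_ ?_ ?_ ?_ ?_
    · exact key.2.differentiableAt
    · filter_upwards [isOpen_hypCutPlane.mem_nhds hw₀] with w hw
      have := hKint.mul_continuousOn (hpow (-a) w hw)
      rw [intervalIntegrable_iff] at this
      exact this.aestronglyMeasurable
    · exact hKint.mul_continuousOn (hpow (-a) w₀ hw₀)
    · have := hKint.mul_continuousOn (g := fun t : ℝ => (-a) * (1 - w₀ * t) ^ (-a - 1) * (-(t : ℂ)))
        ((continuousOn_const.mul (hpow (-a - 1) w₀ hw₀)).mul (by fun_prop))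
      rw [intervalIntegrable_iff] at this
      exact this.aestronglyMeasurable
    · refine ae_of_all _ fun t ht w hw => ?_
      rw [hI] at ht
      rw [norm_mul]
      exact mul_le_mul_of_nonneg_left (hC (w, t) ⟨hw, ht.1.le, ht.2⟩) (norm_nonneg _)
    · exact hKint.norm.mul_const C
    · refine ae_of_all _ fun t ht w hw => ?_
      rw [hI] at ht
      have h1 : HasDerivAt (fun w : ℂ => 1 - w * t) (-(t : ℂ)) w := by
        simpa using ((hasDerivAt_id w).mul_const (t : ℂ)).const_sub 1
      exact (h1.cpow_const (one_sub_mul_mem_slitPlane (hball hw) ht.1.le ht.2)).const_mul _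
  · intro w hw
    have hw1 : ‖w‖ < 1 := by simpa using hw
    set p : ℕ → ℂ := fun k => (ascPochhammer ℂ k).eval a / k.factorial with hp
    have hsumm : Summable fun k => ‖p k‖ * ‖w‖ ^ k := by
      have h := (hasSum_one_sub_cpow a (y := w) hw1).summable.norm
      simpa only [norm_mul, norm_pow] using h
    have key := intervalIntegral.hasSum_integral_of_dominated_convergence
      (μ := volume) (a := (0 : ℝ)) (b := 1)
      (F := fun (k : ℕ) t => K t * (p k * (w * t) ^ k))
      (f := fun t => K t * (1 - w * t) ^ (-a))
      (fun k t => ‖K t‖ * (‖p k‖ * ‖w‖ ^ k)) ?_ ?_ ?_ ?_ ?_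
    · refine HasSum.unique (key.mul_left (Gamma b * Gamma (c - b))⁻¹) ?_
      have hsum := hasSum_regularizedGaussHGFun a b c hw
      refine Eq.mp (congrArg (fun f : ℕ → ℂ => HasSum f _) (funext fun k => ?_)) hsum
      have hbk : 0 < (b + k).re := by
        simp only [add_re, natCast_re]; positivity
      have e1 : ∫ t in (0 : ℝ)..1, K t * (p k * (w * t) ^ k) =
          p k * w ^ k * betaIntegral (b + k) (c - b) := by
        rw [betaIntegral, ← intervalIntegral.integral_const_mul]
        refine intervalIntegral.integral_congr_ae (ae_of_all _ fun t ht => ?_)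
        rw [hI] at ht
        have ht0 : (t : ℂ) ≠ 0 := by exact_mod_cast ht.1.ne'
        rw [hK, show b + (k : ℂ) - 1 = b - 1 + k by ring, cpow_add _ _ ht0, cpow_natCast]
        ring
      have hb0 : ∀ m : ℕ, b ≠ -m := by
        intro m h
        rw [h] at hb
        simp only [neg_re, natCast_re] at hb
        have : (0 : ℝ) ≤ m := Nat.cast_nonneg _
        linarith
      have e2 := Gamma_mul_Gamma_eq_betaIntegral hbk hcb
      rw [show b + (k : ℂ) + (c - b) = c + k by ring] at e2
      have e3 := Gamma_add_nat_div_Gamma_eq (n := k) b hb0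
      have g1 := Gamma_ne_zero_of_re_pos hb
      have g2 := Gamma_ne_zero_of_re_pos hcb
      have g3 : Gamma (c + k) ≠ 0 := Gamma_ne_zero_of_re_pos (by
        simp only [add_re, natCast_re]
        have : (0 : ℝ) ≤ k := Nat.cast_nonneg _
        linarith)
      have g4 : (k.factorial : ℂ) ≠ 0 := by exact_mod_cast k.factorial_ne_zero
      rw [e1, ← e3, hp]
      have e4 : betaIntegral (b + k) (c - b) = Gamma (b + k) * Gamma (c - b) / Gamma (c + k) := by
        rw [e2]; field_simp
      rw [e4]
      field_simp
    · intro k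
      have := hKint.mul_continuousOn (g := fun t : ℝ => p k * (w * t) ^ k) (by fun_prop)
      rw [intervalIntegrable_iff] at this
      exact this.aestronglyMeasurable
    · intro k
      refine ae_of_all _ fun t ht => ?_
      rw [hI] at ht
      rw [norm_mul (K t), norm_mul (p k), norm_pow]
      gcongr
      rw [norm_mul, norm_real, Real.norm_of_nonneg ht.1.le]
      exact mul_le_of_le_one_right (norm_nonneg _) ht.2
    · exact ae_of_all _ fun t _ => hsumm.mul_left _
    · simp only [tsum_mul_left]
      exact hKint.norm.mul_const _
    · refine ae_of_all _ fun t ht => ?_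
      rw [hI] at ht
      refine (hasSum_one_sub_cpow a (y := w * t) ?_).mul_left _
      rw [norm_mul, norm_real, Real.norm_of_nonneg ht.1.le]
      exact (mul_le_of_le_one_right (norm_nonneg _) ht.2).trans_lt hw1

theorem exists_isHypContinuation_of_add_one {a b c : ℂ}
    (h : ∃ F, IsHypContinuation a b (c + 1) F) : ∃ F, IsHypContinuation a b c F := by
  obtain ⟨F, hF, hFs⟩ := h
  refine ⟨fun w => w * deriv F w + c * F w, ?_, ?_⟩
  · exact (differentiableOn_id.mul (hF.deriv isOpen_hypCutPlane)).add (hF.const_mul c)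
  · intro w hw
    have hw1 : ‖w‖ < 1 := by simpa using hw
    obtain ⟨r, hr1, hr2⟩ := exists_between hw1
    have hr0 : 0 ≤ r := (norm_nonneg _).trans hr1.le
    set q : ℕ → ℂ := fun k => (ascPochhammer ℂ k).eval a * (ascPochhammer ℂ k).eval b /
      (k.factorial * Gamma (c + 1 + k)) with hq
    have hs : ∀ y ∈ ball (0 : ℂ) 1, HasSum (fun k => q k * y ^ k) (F y) := fun y hy => by
      rw [hFs hy]
      exact hasSum_regularizedGaussHGFun a b (c + 1) hy
    have hsumm : Summable fun k => ‖q k‖ * r ^ k := by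
      have h := (hs (r : ℂ) (by simpa [abs_of_nonneg hr0] using hr2)).summable.norm
      simpa [norm_mul, norm_pow, abs_of_nonneg hr0] using h
    have hd := hasSum_deriv_of_summable_norm (U := ball (0 : ℂ) r) (z := w)
      (F := fun (k : ℕ) y => q k * y ^ k) hsumm (fun k => by fun_prop) isOpen_ball
      (fun k y hy => by
        have hy' : ‖y‖ ≤ r := (by simpa using hy : ‖y‖ < r).le
        rw [norm_mul, norm_pow]
        gcongr) (by simpa using hr1)
    have hde : deriv (fun y => ∑' k, q k * y ^ k) w = deriv F w := by
      refine Filter.EventuallyEq.deriv_eq ?_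
      filter_upwards [isOpen_ball.mem_nhds hw] with y hy using (hs y hy).tsum_eq
    rw [hde] at hd
    refine HasSum.unique ((hd.mul_left w).add ((hs w hw).mul_left c)) ?_
    have hsum := hasSum_regularizedGaussHGFun a b c hw
    refine Eq.mp (congrArg (fun f : ℕ → ℂ => HasSum f _) (funext fun k => ?_)) hsum
    symm
    have h1 : w * deriv (fun y => q k * y ^ k) w = q k * k * w ^ k := by
      rw [deriv_const_mul_field, deriv_pow_field]
      rcases k with _ | k
      · simp
      · simp only [Nat.add_sub_cancel, pow_succ]
        ring
    rw [h1, hq]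
    have h2 : (c + k) / Gamma (c + 1 + k) = 1 / Gamma (c + k) := by
      rw [show c + 1 + (k : ℂ) = c + k + 1 by ring]
      by_cases h0 : c + (k : ℂ) = 0
      · simp [h0]
      · rw [Gamma_add_one _ h0]
        by_cases hG : Gamma (c + k) = 0
        · simp [hG]
        · field_simp
    calc _ = (ascPochhammer ℂ k).eval a * (ascPochhammer ℂ k).eval b / k.factorial *
          ((c + k) / Gamma (c + 1 + k)) * w ^ k := by
          simp only [div_eq_mul_inv, mul_inv]; ring
      _ = _ := by rw [h2]; simp only [div_eq_mul_inv, mul_inv]; ring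

theorem exists_isHypContinuation_of_re_pos (a : ℂ) {b : ℂ} (c : ℂ) (hb : 0 < b.re) :
    ∃ F, IsHypContinuation a b c F := by
  have key : ∀ (N : ℕ) (c : ℂ), b.re < c.re + N → ∃ F, IsHypContinuation a b c F := by
    intro N
    induction N with
    | zero => exact fun c hc => exists_isHypContinuation_of_re_lt a hb (by simpa using hc)
    | succ N ih =>
      intro c hc
      refine exists_isHypContinuation_of_add_one (ih (c + 1) ?_)
      push_cast at hc
      simp only [add_re, one_re]
      linarith
  obtain ⟨N, hN⟩ := exists_nat_gt (b.re - c.re)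
  exact key N c (by linarith)

theorem exists_isHypContinuation_legendre (ν μ : ℂ) :
    ∃ F, IsHypContinuation (-ν) (ν + 1) (1 - μ) F := by
  rcases lt_or_ge 0 (ν + 1).re with h | h
  · exact exists_isHypContinuation_of_re_pos _ _ h
  · obtain ⟨F, h1, h2⟩ := exists_isHypContinuation_of_re_pos (ν + 1) (b := -ν) (1 - μ) (by
      simp only [add_re, one_re, neg_re] at h ⊢
      linarith)
    refine ⟨F, h1, fun w hw => ?_⟩
    rw [h2 hw, regularizedGaussHGFun_symm]

/-- The regularized Gauss hypergeometric function `F(-ν, ν + 1; 1 - μ; w) / Γ(1 - μ)`, analytically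
continued from the unit disc to `ℂ \ [1, ∞)`. -/
noncomputable def legendreHyp (ν μ : ℂ) : ℂ → ℂ :=
  Classical.choose (exists_isHypContinuation_legendre ν μ)

theorem legendreHyp_spec (ν μ : ℂ) :
    IsHypContinuation (-ν) (ν + 1) (1 - μ) (legendreHyp ν μ) :=
  Classical.choose_spec (exists_isHypContinuation_legendre ν μ)

/-- The associated Legendre function of the first kind `P_ν^μ(z)` of complex degree `ν` and order
`μ` (Hobson's normalization), in the `z`-plane cut along `(-∞, 1]`, with principal powers. -/
noncomputable def assocLegendreP (ν μ z : ℂ) : ℂ :=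
  (z + 1) ^ (μ / 2) / (z - 1) ^ (μ / 2) * legendreHyp ν μ ((1 - z) / 2)

/-! Put x = (z - 1)/2. At order m the first m terms of the regularized series vanish, so the
hypergeometric factor is x^m f_ν(x), where f_ν is differentiable at the singular point 0 and solves
L f = (ν - m)(ν + m + 1) f with L f = x(1 + x)f'' + (m + 1)(1 + 2x)f'. Its value at 0 is an explicit
polynomial in ν. Formally, u = ∂f_ν/∂ν at ν = n solves the inhomogeneous equation with source (2n +
1) f_n, and u(0) is known.

A solution regular at 0 is controlled by its value there and by its source, uniformly for bounded λ
(`exists_bound_isLegendreSol`). This gives uniqueness (`IsLegendreSol.eqOn`). Applied to f_ν - f_n -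
(ν - n)u, whose source is quadratic in ν - n, it also gives differentiability in ν
(`hasDerivAt_isLegendreSol`), with no joint regularity in (ν, x) needed beforehand.

It remains to check that the closed form solves the problem for u. Each of its four terms is an
elementary solution with an explicit source; the sources add up to (2n + 1) f_n
(`isLegendreSol_legendreDegreeDeriv`) and the values at 0 match (`legendreDegreeDeriv_zero`). -/

/-! ### A priori bounds at the regular singular point 0. -/

/-- The complex plane cut along `(-∞, -1]`. -/
def legendreCutPlane : Set ℂ := {x | 1 + x ∈ slitPlane}

theorem ofReal_mul_mem_legendreCutPlane {x : ℂ} (hx : x ∈ legendreCutPlane) {s : ℝ}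
    (hs : s ∈ Icc (0 : ℝ) 1) : (s : ℂ) * x ∈ legendreCutPlane := by
  have := one_sub_mul_mem_slitPlane (w := -x) (t := s)
    (by simpa [hypCutPlane, legendreCutPlane] using hx) hs.1 hs.2
  simpa [legendreCutPlane, mul_comm] using this

theorem one_add_ne_zero_of_mem_legendreCutPlane {x : ℂ} (hx : x ∈ legendreCutPlane) :
    1 + x ≠ 0 := slitPlane_ne_zero hx

/-- `f` solves `x(1 + x)f'' + c(1 + 2x)f' - λf = h` with `c = m + 1` on the cut plane. -/
def IsLegendreSol (m : ℕ) (lam : ℂ) (h f : ℂ → ℂ) : Prop :=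
  ∃ f₁ f₂ : ℂ → ℂ, ∀ x ∈ legendreCutPlane, HasDerivAt f (f₁ x) x ∧ HasDerivAt f₁ (f₂ x) x ∧
    x * (1 + x) * f₂ x + (m + 1) * (1 + 2 * x) * f₁ x - lam * f x = h x

/-- With the integrating factor (x(1 + x))^m the equation becomes ((x(1 + x))^(m+1) f')' = (x(1 +
x))^m (λf + h). Integrating along the segment from 0, where the bracket vanishes, bounds f' by f and
h without a boundary term. -/
theorem norm_deriv_le_of_isLegendreSol {m : ℕ} {lam : ℂ} {h f f₁ f₂ : ℂ → ℂ}
    (hf : ∀ x ∈ legendreCutPlane, HasDerivAt f (f₁ x) x ∧ HasDerivAt f₁ (f₂ x) x ∧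
      x * (1 + x) * f₂ x + (m + 1) * (1 + 2 * x) * f₁ x - lam * f x = h x)
    {x : ℂ} (hx : x ∈ legendreCutPlane) {α M : ℝ} (hα : 0 < α) (hα1 : α ≤ 1)
    (hαx : α ≤ ‖1 + x‖)
    (hM : ∀ t ∈ Icc (0 : ℝ) 1, ‖lam * f (t * x) + h (t * x)‖ ≤ M) :
    ‖f₁ x‖ ≤ (1 + ‖x‖) ^ m / α ^ (m + 1) * M := by
  have hM0 : 0 ≤ M := (norm_nonneg _).trans (hM 0 (by simp))
  rcases eq_or_ne x 0 with rfl | hx0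
  · have h1 := (hf 0 hx).2.2
    have h2 := hM 0 (by simp)
    simp only [mul_zero] at h2
    rw [← h1] at h2
    have h3 : ‖((m : ℂ) + 1) * f₁ 0‖ ≤ M := by
      refine le_trans (le_of_eq ?_) h2
      congr 1
      ring
    rw [norm_mul] at h3
    have h4 : ‖(m : ℂ) + 1‖ = m + 1 := by
      exact_mod_cast Complex.norm_natCast (m + 1)
    rw [h4] at h3
    have h5 : 1 ≤ (1 + ‖(0 : ℂ)‖) ^ m / α ^ (m + 1) := by
      simp only [norm_zero, add_zero, one_pow]
      exact one_le_one_div (by positivity) (pow_le_one₀ hα.le hα1)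
    have h6 : ‖f₁ 0‖ ≤ M := by
      nlinarith [norm_nonneg (f₁ 0), mul_nonneg (Nat.cast_nonneg (α := ℝ) m) (norm_nonneg (f₁ 0))]
    nlinarith
  · set Φ : ℝ → ℂ := fun t => (t * x * (1 + t * x)) ^ (m + 1) * f₁ (t * x) with hΦ
    have hd : ∀ t ∈ Icc (0 : ℝ) 1, HasDerivWithinAt Φ
        (x * ((t * x * (1 + t * x)) ^ m * (lam * f (t * x) + h (t * x)))) (Icc 0 1) t := by
      intro t ht
      obtain ⟨-, h2, h3⟩ := hf _ (ofReal_mul_mem_legendreCutPlane hx ht)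
      have e1 : HasDerivAt (fun t : ℝ => (t : ℂ) * x) x t := by
        simpa using (ofRealCLM.hasDerivAt (x := t)).mul_const x
      have e2 : HasDerivAt (fun y : ℂ => (y * (1 + y)) ^ (m + 1) * f₁ y)
          ((t * x * (1 + t * x)) ^ m * (lam * f (t * x) + h (t * x))) (t * x) := by
        have e3 : HasDerivAt (fun y : ℂ => y * (1 + y)) (1 + 2 * (t * x)) (t * x) := by
          refine ((hasDerivAt_id ((t : ℂ) * x)).mul
            ((hasDerivAt_id ((t : ℂ) * x)).const_add 1)).congr_deriv ?_
          simp only [id]; ring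
        refine ((e3.pow (m + 1)).mul h2).congr_deriv ?_
        rw [← h3, Nat.add_sub_cancel]
        push_cast
        simp only [Pi.pow_apply]
        ring
      have := e2.comp t e1
      refine HasDerivAt.hasDerivWithinAt (this.congr_deriv ?_)
      ring
    have hb := norm_image_sub_le_of_norm_deriv_le_segment_01' (f := Φ)
      (C := ‖x‖ * ((‖x‖ * (1 + ‖x‖)) ^ m * M)) hd (by
        intro t ht
        have ht' : t ∈ Icc (0 : ℝ) 1 := Ico_subset_Icc_self ht
        have n1 : ‖(t : ℂ) * x‖ ≤ ‖x‖ := by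
          rw [norm_mul, norm_real, Real.norm_of_nonneg ht'.1]
          exact mul_le_of_le_one_left (norm_nonneg _) ht'.2
        rw [norm_mul, norm_mul, norm_pow, norm_mul]
        gcongr
        · refine (norm_add_le _ _).trans ?_
          rw [norm_one]
          gcongr
        · exact hM t ht')
    have hΦ1 : Φ 1 = (x * (1 + x)) ^ (m + 1) * f₁ x := by simp [hΦ]
    have hΦ0 : Φ 0 = 0 := by simp [hΦ]
    rw [hΦ0, hΦ1, sub_zero, norm_mul, norm_pow, norm_mul] at hb
    have hxp : 0 < ‖x‖ := norm_pos_iff.2 hx0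
    -- Both sides carry the same power of ‖x‖, so the bound does not degenerate as x tends to 0.
    have h1 : ‖x‖ ^ (m + 1) * (α ^ (m + 1) * ‖f₁ x‖) ≤
        ‖x‖ ^ (m + 1) * ((1 + ‖x‖) ^ m * M) := by
      calc _ = (‖x‖ * α) ^ (m + 1) * ‖f₁ x‖ := by rw [mul_pow]; ring
        _ ≤ (‖x‖ * ‖1 + x‖) ^ (m + 1) * ‖f₁ x‖ := by gcongr
        _ ≤ _ := hb
        _ = _ := by rw [mul_pow]; ring
    have h2 := le_of_mul_le_mul_left h1 (by positivity)
    rw [div_mul_eq_mul_div, le_div_iff₀ (by positivity)]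
    linarith

/-- A Gronwall argument along the segment from 0 to x in the sup norm weighted by exp(-Ls). The
constant depends only on m, x and K, so it serves all λ near a given value at once. -/
theorem exists_bound_isLegendreSol (m : ℕ) {x : ℂ} (hx : x ∈ legendreCutPlane) {K : ℝ}
    (hK : 0 ≤ K) : ∃ C : ℝ, ∀ (lam : ℂ) (h f : ℂ → ℂ) (H : ℝ), IsLegendreSol m lam h f →
      ‖lam‖ ≤ K → (∀ s ∈ Icc (0 : ℝ) 1, ‖h (s * x)‖ ≤ H) → ‖f x‖ ≤ C * (‖f 0‖ + H) := by
  have hc1 : Continuous fun s : ℝ => ‖1 + (s : ℂ) * x‖ := by fun_prop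
  obtain ⟨s₁, hs₁, hmin⟩ := isCompact_Icc.exists_isMinOn (nonempty_Icc.2 (zero_le_one (α := ℝ)))
    hc1.continuousOn
  set α : ℝ := ‖1 + (s₁ : ℂ) * x‖ with hα
  have hα0 : 0 < α := norm_pos_iff.2
    (one_add_ne_zero_of_mem_legendreCutPlane (ofReal_mul_mem_legendreCutPlane hx hs₁))
  have hαle : ∀ s ∈ Icc (0 : ℝ) 1, α ≤ ‖1 + (s : ℂ) * x‖ := fun s hs => hmin hs
  have hα1 : α ≤ 1 := by simpa using hαle 0 (by simp)
  set B : ℝ := ‖x‖ * ((1 + ‖x‖) ^ m / α ^ (m + 1)) with hB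
  have hB0 : 0 ≤ B := by positivity
  -- L is large enough that the term B·K·S/L is at most S/2 and can be absorbed into the left side.
  set L : ℝ := 2 * (B * K + 1) with hL
  have hL0 : 0 < L := by positivity
  refine ⟨Real.exp L * (2 * (1 + B)), fun lam h f H ⟨f₁, f₂, hf⟩ hlam hH => ?_⟩
  have hH0 : 0 ≤ H := (norm_nonneg _).trans (hH 0 (by simp))
  have hfc : ContinuousOn (fun s : ℝ => f (s * x)) (Icc 0 1) := by
    intro s hs
    have h1 : ContinuousAt (fun s : ℝ => (s : ℂ) * x) s := by fun_prop
    exact (ContinuousAt.comp (f := fun s : ℝ => (s : ℂ) * x)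
      (hf _ (ofReal_mul_mem_legendreCutPlane hx hs)).1.continuousAt h1).continuousWithinAt
  have hgc : ContinuousOn (fun s : ℝ => ‖f (s * x)‖ * Real.exp (-(L * s))) (Icc 0 1) :=
    hfc.norm.mul (by fun_prop)
  obtain ⟨s₂, hs₂, hmax⟩ := isCompact_Icc.exists_isMaxOn (nonempty_Icc.2 (zero_le_one (α := ℝ))) hgc
  set S : ℝ := ‖f (s₂ * x)‖ * Real.exp (-(L * s₂)) with hS
  have hS0 : 0 ≤ S := by positivity
  have hfS : ∀ s ∈ Icc (0 : ℝ) 1, ‖f (s * x)‖ ≤ S * Real.exp (L * s) := by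
    intro s hs
    have h1 : ‖f (s * x)‖ * Real.exp (-(L * s)) ≤ S := hmax hs
    rwa [Real.exp_neg, ← div_eq_mul_inv, div_le_iff₀ (Real.exp_pos _)] at h1
  have hder : ∀ s ∈ Icc (0 : ℝ) 1, ‖x * f₁ (s * x)‖ ≤ B * (K * S * Real.exp (L * s) + H) := by
    intro s hs
    have h1 := norm_deriv_le_of_isLegendreSol hf (ofReal_mul_mem_legendreCutPlane hx hs) hα0 hα1
      (hαle s hs) (M := K * S * Real.exp (L * s) + H) (by
        intro t ht
        have hts : t * s ∈ Icc (0 : ℝ) 1 := ⟨mul_nonneg ht.1 hs.1, mul_le_one₀ ht.2 hs.1 hs.2⟩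
        have e1 : (t : ℂ) * (s * x) = ((t * s : ℝ) : ℂ) * x := by push_cast; ring
        rw [e1]
        refine (norm_add_le _ _).trans (add_le_add ?_ (hH _ hts))
        rw [norm_mul, mul_assoc]
        have e2 : t * s ≤ s := mul_le_of_le_one_left hs.1 ht.2
        refine mul_le_mul hlam ((hfS _ hts).trans ?_) (norm_nonneg _) hK
        gcongr)
    have n1 : ‖(s : ℂ) * x‖ ≤ ‖x‖ := by
      rw [norm_mul, norm_real, Real.norm_of_nonneg hs.1]
      exact mul_le_of_le_one_left (norm_nonneg _) hs.2
    rw [norm_mul, hB, mul_assoc]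
    refine mul_le_mul_of_nonneg_left (h1.trans ?_) (norm_nonneg _)
    gcongr
  have key := image_norm_le_of_norm_deriv_right_le_deriv_boundary' (a := (0 : ℝ)) (b := 1)
    (f := fun s : ℝ => f (s * x)) (f' := fun s : ℝ => x * f₁ (s * x))
    (B := fun s => ‖f 0‖ + B * (K * S * (Real.exp (L * s) / L) + H * s))
    (B' := fun s => B * (K * S * Real.exp (L * s) + H)) hfc ?_ ?_ (by fun_prop) ?_
    (fun s hs => hder s (Ico_subset_Icc_self hs)) hs₂
  · have h1 : S ≤ ‖f 0‖ + B * (K * S / L + H) := by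
      have e1 : Real.exp (-(L * s₂)) ≤ 1 := Real.exp_le_one_iff.2 (by
        have := mul_nonneg hL0.le hs₂.1
        linarith)
      have e2 : Real.exp (L * s₂) * Real.exp (-(L * s₂)) = 1 := by
        rw [← Real.exp_add]; simp
      have e3 : 0 ≤ ‖f 0‖ + B * (H * s₂) := by
        have := hs₂.1
        positivity
      calc S ≤ (‖f 0‖ + B * (K * S * (Real.exp (L * s₂) / L) + H * s₂)) *
            Real.exp (-(L * s₂)) := by
            rw [hS]; gcongr
        _ = (‖f 0‖ + B * (H * s₂)) * Real.exp (-(L * s₂)) +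
            B * (K * S / L) * (Real.exp (L * s₂) * Real.exp (-(L * s₂))) := by ring
        _ ≤ (‖f 0‖ + B * (H * s₂)) * 1 + B * (K * S / L) * 1 := by
            rw [e2]; gcongr
        _ ≤ (‖f 0‖ + B * (H * 1)) * 1 + B * (K * S / L) * 1 := by
            have := hs₂.2
            gcongr
        _ = _ := by ring
    have h2 : B * (K * S / L) ≤ S / 2 := by
      rw [← mul_div_assoc, div_le_iff₀ hL0, hL]
      nlinarith
    have h3 : S ≤ 2 * (1 + B) * (‖f 0‖ + H) := by
      nlinarith [norm_nonneg (f 0), mul_nonneg hB0 (norm_nonneg (f 0))]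
    have h4 := hfS 1 (by simp)
    simp only [ofReal_one, one_mul, mul_one] at h4
    calc ‖f x‖ ≤ S * Real.exp L := h4
      _ ≤ 2 * (1 + B) * (‖f 0‖ + H) * Real.exp L := by gcongr
      _ = _ := by ring
  · intro s hs
    have h1 : HasDerivAt (fun t : ℝ => (t : ℂ) * x) x s := by
      simpa using (ofRealCLM.hasDerivAt (x := s)).mul_const x
    have h2 := (hf _ (ofReal_mul_mem_legendreCutPlane hx (Ico_subset_Icc_self hs))).1.comp s h1
    exact (h2.congr_deriv (by ring)).hasDerivWithinAt
  · simp only [ofReal_zero, zero_mul, mul_zero, add_zero]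
    have : 0 ≤ B * (K * S * (Real.exp 0 / L)) := by positivity
    linarith
  · intro s _
    have h1 : HasDerivAt (fun s : ℝ => Real.exp (L * s) / L) (Real.exp (L * s)) s := by
      have := ((hasDerivAt_id s).const_mul L).exp.div_const L
      refine this.congr_deriv ?_
      simp only [id]
      field_simp
    have h2 := ((((h1.const_mul (K * S)).add ((hasDerivAt_id s).const_mul H)).const_mul B).const_add
      ‖f 0‖)
    exact (h2.congr_deriv (by ring)).hasDerivWithinAt

/-! ### Linearity, uniqueness and dependence on the parameter. -/

theorem IsLegendreSol.add {m : ℕ} {lam : ℂ} {h f k g : ℂ → ℂ} (hf : IsLegendreSol m lam h f)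
    (hg : IsLegendreSol m lam k g) :
    IsLegendreSol m lam (fun x => h x + k x) (fun x => f x + g x) := by
  obtain ⟨f₁, f₂, hf⟩ := hf
  obtain ⟨g₁, g₂, hg⟩ := hg
  refine ⟨fun x => f₁ x + g₁ x, fun x => f₂ x + g₂ x, fun x hx => ?_⟩
  obtain ⟨a1, a2, a3⟩ := hf x hx
  obtain ⟨b1, b2, b3⟩ := hg x hx
  refine ⟨a1.add b1, a2.add b2, ?_⟩
  linear_combination a3 + b3

theorem IsLegendreSol.const_mul {m : ℕ} {lam : ℂ} {h f : ℂ → ℂ} (hf : IsLegendreSol m lam h f)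
    (c : ℂ) : IsLegendreSol m lam (fun x => c * h x) (fun x => c * f x) := by
  obtain ⟨f₁, f₂, hf⟩ := hf
  refine ⟨fun x => c * f₁ x, fun x => c * f₂ x, fun x hx => ?_⟩
  obtain ⟨a1, a2, a3⟩ := hf x hx
  refine ⟨a1.const_mul c, a2.const_mul c, ?_⟩
  linear_combination c * a3

/-- Moving a multiple of f into the source lets solutions for different λ be subtracted within one
equation. -/
theorem IsLegendreSol.shift {m : ℕ} {lam : ℂ} {h f : ℂ → ℂ} (hf : IsLegendreSol m lam h f)
    (δ : ℂ) : IsLegendreSol m (lam + δ) (fun x => h x - δ * f x) f := by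
  obtain ⟨f₁, f₂, hf⟩ := hf
  refine ⟨f₁, f₂, fun x hx => ?_⟩
  obtain ⟨a1, a2, a3⟩ := hf x hx
  refine ⟨a1, a2, ?_⟩
  linear_combination a3

theorem IsLegendreSol.congr_right {m : ℕ} {lam : ℂ} {h k f : ℂ → ℂ} (hf : IsLegendreSol m lam h f)
    (hk : ∀ x ∈ legendreCutPlane, h x = k x) : IsLegendreSol m lam k f := by
  obtain ⟨f₁, f₂, hf⟩ := hf
  refine ⟨f₁, f₂, fun x hx => ?_⟩
  obtain ⟨a1, a2, a3⟩ := hf x hx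
  exact ⟨a1, a2, a3.trans (hk x hx)⟩

theorem IsLegendreSol.continuousAt {m : ℕ} {lam : ℂ} {h f : ℂ → ℂ} (hf : IsLegendreSol m lam h f)
    {x : ℂ} (hx : x ∈ legendreCutPlane) : ContinuousAt f x := by
  obtain ⟨f₁, f₂, hf⟩ := hf
  exact (hf x hx).1.continuousAt

/-- A solution that is regular at the singular point `0` is determined by its value there. -/
theorem IsLegendreSol.eqOn {m : ℕ} {lam : ℂ} {h f g : ℂ → ℂ} (hf : IsLegendreSol m lam h f)
    (hg : IsLegendreSol m lam h g) (h0 : f 0 = g 0) : EqOn f g legendreCutPlane := by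
  intro x hx
  obtain ⟨C, hC⟩ := exists_bound_isLegendreSol m hx (norm_nonneg lam)
  have h1 := hC lam _ _ 0 (hf.add (hg.const_mul (-1))) le_rfl (fun s _ => by simp)
  simp only [h0, neg_mul, one_mul, add_neg_cancel, norm_zero, add_zero, mul_zero] at h1
  have h2 := norm_le_zero_iff.1 h1
  linear_combination h2

/-- If solutions `f ν` of the homogeneous equations with parameter `lam ν` are regular at `0`,
differentiability in `ν` propagates from `0` to the cut plane. -/
theorem hasDerivAt_isLegendreSol {m : ℕ} {lam : ℂ → ℂ} {f : ℂ → ℂ → ℂ} {ν₀ : ℂ} {u : ℂ → ℂ}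
    (hlam : ∀ ν, lam ν = lam ν₀ + (ν - ν₀) * (ν + ν₀ + 1))
    (hf : ∀ᶠ ν in nhds ν₀, IsLegendreSol m (lam ν) (fun _ => 0) (f ν))
    (hu : IsLegendreSol m (lam ν₀) (fun x => (2 * ν₀ + 1) * f ν₀ x) u)
    (h0 : HasDerivAt (fun ν => f ν 0) (u 0) ν₀) {x : ℂ} (hx : x ∈ legendreCutPlane) :
    HasDerivAt (fun ν => f ν x) (u x) ν₀ := by
  have hf0 : IsLegendreSol m (lam ν₀) (fun _ => 0) (f ν₀) := hf.self_of_nhds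
  have hcont : ∀ g : ℂ → ℂ, (∀ y ∈ legendreCutPlane, ContinuousAt g y) →
      ∃ M, ∀ s ∈ Icc (0 : ℝ) 1, ‖g (s * x)‖ ≤ M := by
    intro g hg
    refine isCompact_Icc.exists_bound_of_continuousOn (f := fun s : ℝ => g (s * x))
      fun s hs => ?_
    have h1 : ContinuousAt (fun s : ℝ => (s : ℂ) * x) s := by fun_prop
    exact (ContinuousAt.comp (f := fun s : ℝ => (s : ℂ) * x)
      (hg _ (ofReal_mul_mem_legendreCutPlane hx hs)) h1).continuousWithinAt
  obtain ⟨M₁, hM₁⟩ := hcont (f ν₀) fun y hy => hf0.continuousAt hy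
  obtain ⟨M₂, hM₂⟩ := hcont u fun y hy => hu.continuousAt hy
  have hM₁0 := (norm_nonneg _).trans (hM₁ 0 (by simp))
  have hM₂0 := (norm_nonneg _).trans (hM₂ 0 (by simp))
  -- Bounds ν + ν₀ + 1 on the unit disc around ν₀.
  set K' : ℝ := 2 * ‖ν₀‖ + 2 with hK'
  obtain ⟨C, hC⟩ := exists_bound_isLegendreSol m hx (K := ‖lam ν₀‖ + 1 * K') (by positivity)
  rw [hasDerivAt_iff_isLittleO] at h0 ⊢
  have hsq : (fun ν : ℂ => ‖ν - ν₀‖ ^ 2 * (M₁ + K' * M₂)) =o[nhds ν₀] fun ν => ν - ν₀ := by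
    have h1 := (Asymptotics.isLittleO_pow_sub_sub ν₀ (m := 2) one_lt_two).const_mul_left
      (M₁ + K' * M₂)
    exact h1.congr_left fun ν => mul_comm _ _
  refine Asymptotics.IsBigO.trans_isLittleO ?_ (h0.norm_left.add hsq)
  refine Asymptotics.IsBigO.of_bound |C| ?_
  filter_upwards [hf, ball_mem_nhds ν₀ one_pos] with ν hν hν1
  have hd : ‖ν - ν₀‖ ≤ 1 := by
    have := mem_ball_iff_norm.1 hν1
    exact this.le
  have hn : ‖ν + ν₀ + 1‖ ≤ K' := by
    calc ‖ν + ν₀ + 1‖ = ‖(ν - ν₀) + 2 * ν₀ + 1‖ := by congr 1; ring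
      _ ≤ ‖ν - ν₀‖ + ‖2 * ν₀‖ + ‖(1 : ℂ)‖ := norm_add₃_le
      _ ≤ 1 + 2 * ‖ν₀‖ + 1 := by
        rw [norm_mul, norm_one, Complex.norm_ofNat]; gcongr
      _ = K' := by ring
  set δ : ℂ := (ν - ν₀) * (ν + ν₀ + 1) with hδ
  have s1 := hf0.shift δ
  have s2 := hu.shift δ
  rw [← hlam ν] at s1 s2
  have s3 := (hν.add (s1.const_mul (-1))).add (s2.const_mul (-(ν - ν₀)))
  -- The first-order part of the source cancels because (ν + ν₀ + 1) - (2ν₀ + 1) = ν - ν₀; this is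
  -- why u has source (2ν₀ + 1) f ν₀.
  have s4 := s3.congr_right (k := fun y => (ν - ν₀) ^ 2 * (f ν₀ y + (ν + ν₀ + 1) * u y))
    (fun y _ => by simp only [hδ]; ring)
  have hb := hC _ _ _ (‖ν - ν₀‖ ^ 2 * (M₁ + K' * M₂)) s4 (by
    rw [hlam ν]
    refine (norm_add_le _ _).trans ?_
    rw [norm_mul]
    gcongr) (by
    intro s hs
    rw [norm_mul, norm_pow]
    gcongr
    refine (norm_add_le _ _).trans (add_le_add (hM₁ s hs) ?_)
    rw [norm_mul]
    exact mul_le_mul hn (hM₂ s hs) (norm_nonneg _) (by positivity))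
  have e : ∀ y, f ν y + -1 * f ν₀ y + -(ν - ν₀) * u y = f ν y - f ν₀ y - (ν - ν₀) • u y := by
    intro y
    rw [smul_eq_mul]; ring
  rw [e, e] at hb
  have hnn : 0 ≤ ‖f ν 0 - f ν₀ 0 - (ν - ν₀) • u 0‖ + ‖ν - ν₀‖ ^ 2 * (M₁ + K' * M₂) := by positivity
  rw [Real.norm_of_nonneg hnn]
  exact hb.trans (mul_le_mul_of_nonneg_right (le_abs_self C) hnn)

/-! ### The hypergeometric equation for the continued function. -/

theorem hasSum_mul_deriv_of_hasSum {q : ℕ → ℂ} {F : ℂ → ℂ}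
    (hs : ∀ y ∈ ball (0 : ℂ) 1, HasSum (fun k => q k * y ^ k) (F y)) {w : ℂ}
    (hw : w ∈ ball (0 : ℂ) 1) : HasSum (fun k : ℕ => k * q k * w ^ k) (w * deriv F w) := by
  have hw1 : ‖w‖ < 1 := by simpa using hw
  obtain ⟨r, hr1, hr2⟩ := exists_between hw1
  have hr0 : 0 ≤ r := (norm_nonneg _).trans hr1.le
  have hsumm : Summable fun k => ‖q k‖ * r ^ k := by
    have h := (hs (r : ℂ) (by simpa [abs_of_nonneg hr0] using hr2)).summable.norm
    simpa [norm_mul, norm_pow, abs_of_nonneg hr0] using h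
  have hd := hasSum_deriv_of_summable_norm (U := ball (0 : ℂ) r) (z := w)
    (F := fun (k : ℕ) y => q k * y ^ k) hsumm (fun k => by fun_prop) isOpen_ball
    (fun k y hy => by
      have hy' : ‖y‖ ≤ r := (by simpa using hy : ‖y‖ < r).le
      rw [norm_mul, norm_pow]
      gcongr) (by simpa using hr1)
  have hde : deriv (fun y => ∑' k, q k * y ^ k) w = deriv F w := by
    refine Filter.EventuallyEq.deriv_eq ?_
    filter_upwards [isOpen_ball.mem_nhds hw] with y hy using (hs y hy).tsum_eq
  rw [hde] at hd
  refine Eq.mp (congrArg (fun f : ℕ → ℂ => HasSum f _) (funext fun k => ?_)) (hd.mul_left w)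
  rw [deriv_const_mul_field, deriv_pow_field]
  rcases k with _ | k
  · simp
  · simp only [Nat.add_sub_cancel, pow_succ]
    ring

/-- Valid at the poles too, so the coefficient recurrence needs no restriction on c. -/
theorem div_Gamma_add_one (s : ℂ) : s / Gamma (s + 1) = 1 / Gamma s := by
  by_cases h0 : s = 0
  · simp [h0]
  · rw [Gamma_add_one _ h0]
    by_cases hG : Gamma s = 0
    · simp [hG]
    · field_simp

theorem isPreconnected_hypCutPlane : IsPreconnected hypCutPlane := by
  have hstar : StarConvex ℝ 0 hypCutPlane := by
    intro w hw s t hs ht hst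
    have := one_sub_mul_mem_slitPlane hw ht (by linarith)
    simpa [hypCutPlane, mul_comm] using this
  exact (hstar.isPathConnected (ball_subset_hypCutPlane (by simp))).isConnected.isPreconnected

/-- The hypergeometric differential equation. -/
theorem IsHypContinuation.ode {a b c : ℂ} {F : ℂ → ℂ} (hF : IsHypContinuation a b c F) {w : ℂ}
    (hw : w ∈ hypCutPlane) :
    w * (1 - w) * deriv (deriv F) w + (c - (a + b + 1) * w) * deriv F w - a * b * F w = 0 := by
  have hd1 := hF.1.deriv isOpen_hypCutPlane
  have hd2 := hd1.deriv isOpen_hypCutPlane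
  have h0 : (0 : ℂ) ∈ hypCutPlane := ball_subset_hypCutPlane (by simp)
  set E : ℂ → ℂ := fun w => w * (1 - w) * deriv (deriv F) w +
    (c - (a + b + 1) * w) * deriv F w - a * b * F w with hE
  have hEd : DifferentiableOn ℂ E hypCutPlane := by
    have h1 := hF.1
    fun_prop
  refine (hEd.analyticOnNhd isOpen_hypCutPlane).eqOn_of_preconnected_of_frequently_eq
    (g := fun _ => 0) analyticOnNhd_const isPreconnected_hypCutPlane h0 ?_ hw
  refine Filter.Eventually.frequently ?_
  filter_upwards [self_mem_nhdsWithin,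
    mem_nhdsWithin_of_mem_nhds (ball_mem_nhds (0 : ℂ) one_pos)] with y hy0 hy
  -- After multiplication by y only θ = y d/dy occurs: the equation becomes θ(θ + c - 1)F = y(θ +
  -- a)(θ + b)F, a comparison of power series.
  refine (mul_eq_zero.1 ?_).resolve_left hy0
  set q : ℕ → ℂ := fun k => (ascPochhammer ℂ k).eval a * (ascPochhammer ℂ k).eval b /
    (k.factorial * Gamma (c + k)) with hq
  have hs : ∀ y ∈ ball (0 : ℂ) 1, HasSum (fun k => q k * y ^ k) (F y) := fun y hy => by
    rw [hF.2 hy]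
    exact hasSum_regularizedGaussHGFun a b c hy
  have hs1 : ∀ y ∈ ball (0 : ℂ) 1, HasSum (fun k => (k * q k) * y ^ k) (y * deriv F y) :=
    fun y hy => hasSum_mul_deriv_of_hasSum hs hy
  have hs2 := hasSum_mul_deriv_of_hasSum hs1 hy
  have hyc := isOpen_hypCutPlane.mem_nhds (ball_subset_hypCutPlane hy)
  have hdd : deriv (fun y => y * deriv F y) y = deriv F y + y * deriv (deriv F) y := by
    have := (hasDerivAt_id y).mul (hd1.differentiableAt hyc).hasDerivAt
    refine Eq.trans this.deriv ?_
    simp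
  rw [hdd] at hs2
  have hL := hs2.add ((hs1 y hy).mul_left (c - 1))
  have hR := ((hs2.add ((hs1 y hy).mul_left (a + b))).add ((hs y hy).mul_left (a * b))).mul_left y
  have hrec : ∀ k : ℕ, (k + 1) * (c + k) * q (k + 1) = (a + k) * (b + k) * q k := by
    intro k
    have g4 : (k.factorial : ℂ) ≠ 0 := by exact_mod_cast k.factorial_ne_zero
    have g5 : (k : ℂ) + 1 ≠ 0 := by exact_mod_cast k.succ_ne_zero
    have h2 := div_Gamma_add_one (c + k)
    calc (k + 1) * (c + k) * q (k + 1) = (a + k) * (b + k) * ((ascPochhammer ℂ k).eval a *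
          (ascPochhammer ℂ k).eval b / k.factorial) * ((c + k) / Gamma (c + k + 1)) := by
          simp only [hq, ascPochhammer_succ_eval, Nat.factorial_succ]
          push_cast
          rw [← add_assoc c]
          field_simp
      _ = _ := by
          rw [h2]
          simp only [hq]
          rw [div_mul_eq_div_mul_one_div _ (k.factorial : ℂ)]
          ring
  rw [← hasSum_nat_add_iff' 1] at hL
  have := hL.unique (Eq.mp (congrArg (fun f : ℕ → ℂ => HasSum f _) (funext fun k => ?_)) hR)
  · simp only [Finset.sum_range_one] at this
    simp only [hE]
    simp only [CharP.cast_eq_zero, zero_mul, mul_zero, add_zero, sub_zero] at this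
    linear_combination this
  · rw [pow_succ]
    push_cast
    linear_combination (-(y ^ k * y)) * hrec k

/-- The continuation of the regularized hypergeometric series in the variable `x = -w`. -/
theorem IsHypContinuation.isLegendreSol {m : ℕ} {ν : ℂ} {F : ℂ → ℂ}
    (hF : IsHypContinuation (m - ν) (m + ν + 1) (1 + m) F) :
    IsLegendreSol m ((ν - m) * (ν + m + 1)) (fun _ => 0) (fun x => F (-x)) := by
  have hd1 := hF.1.deriv isOpen_hypCutPlane
  refine ⟨fun x => -deriv F (-x), fun x => deriv (deriv F) (-x), fun x hx => ?_⟩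
  have hx' : -x ∈ hypCutPlane := by simpa [hypCutPlane, legendreCutPlane] using hx
  have hn := isOpen_hypCutPlane.mem_nhds hx'
  refine ⟨?_, ?_, ?_⟩
  · have := (hF.1.differentiableAt hn).hasDerivAt.comp x (hasDerivAt_neg x)
    exact this.congr_deriv (by ring)
  · have := ((hd1.differentiableAt hn).hasDerivAt.comp x (hasDerivAt_neg x)).neg
    exact this.congr_deriv (by ring)
  · have := hF.ode hx'
    linear_combination -this

/-! ### Integer order: splitting off the power x^m, and the value at 0. -/

/-- The factor `(-ν)ₘ (ν + 1)ₘ (-1)ᵐ`. -/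
noncomputable def legendreCoeff (m : ℕ) (ν : ℂ) : ℂ :=
  ∏ i ∈ Finset.range m, ((ν - i) * (ν + 1 + i))

theorem ascPochhammer_eval_mul_eq_legendreCoeff (m : ℕ) (ν : ℂ) :
    (ascPochhammer ℂ m).eval (-ν) * (ascPochhammer ℂ m).eval (ν + 1) =
      (-1) ^ m * legendreCoeff m ν := by
  induction m with
  | zero => simp [legendreCoeff]
  | succ m ih =>
    rw [legendreCoeff, Finset.prod_range_succ, ← legendreCoeff, ascPochhammer_succ_eval,
      ascPochhammer_succ_eval]
    linear_combination (-ν + m) * (ν + 1 + m) * ih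

theorem ascPochhammer_add_eval (m k : ℕ) (a : ℂ) :
    (ascPochhammer ℂ (m + k)).eval a =
      (ascPochhammer ℂ m).eval a * (ascPochhammer ℂ k).eval (a + m) := by
  rw [← ascPochhammer_mul]
  simp

/-- Factorization of the hypergeometric function at `c = 1 - m` by `wᵐ`. -/
theorem legendreHyp_natCast_eq {m : ℕ} {ν : ℂ} {F : ℂ → ℂ}
    (hF : IsHypContinuation (m - ν) (m + ν + 1) (1 + m) F) {x : ℂ} (hx : x ∈ legendreCutPlane) :
    legendreHyp ν m (-x) = x ^ m * (legendreCoeff m ν * F (-x)) := by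
  have hx' : -x ∈ hypCutPlane := by simpa [hypCutPlane, legendreCutPlane] using hx
  have hG : IsHypContinuation (-ν) (ν + 1) (1 - m)
      (fun w => w ^ m * ((-1) ^ m * legendreCoeff m ν * F w)) := by
    refine ⟨?_, fun w hw => ?_⟩
    · have := hF.1
      fun_prop
    · have h1 := hasSum_regularizedGaussHGFun (-ν) (ν + 1) (1 - m) hw
      have h2 := hasSum_regularizedGaussHGFun (m - ν) (m + ν + 1) (1 + m) hw
      rw [← hF.2 hw] at h2
      rw [← hasSum_nat_add_iff' m] at h1
      have hz : ∑ k ∈ Finset.range m, (ascPochhammer ℂ k).eval (-ν) *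
          (ascPochhammer ℂ k).eval (ν + 1) / (k.factorial * Gamma (1 - m + k)) * w ^ k = 0 := by
        refine Finset.sum_eq_zero fun k hk => ?_
        have hk := Finset.mem_range.1 hk
        have : Gamma (1 - (m : ℂ) + k) = 0 := by
          rw [Gamma_eq_zero_iff]
          refine ⟨m - 1 - k, ?_⟩
          rw [Nat.cast_sub (by omega), Nat.cast_sub (by omega)]
          push_cast
          ring
        simp [this]
      rw [hz, sub_zero] at h1
      simp only [← mul_assoc (w ^ m)]
      refine HasSum.unique (Eq.mp (congrArg (fun f : ℕ → ℂ => HasSum f _)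
        (funext fun k => ?_)) (h2.mul_left (w ^ m * (-1) ^ m * legendreCoeff m ν))) h1
      -- In the term of index m + k the factors k! and (m + k)! exchange their roles: Γ(1 - m + (m +
      -- k)) = k!, while (m + k)! is Γ(1 + m + k) on the other side.
      rw [add_comm k m, ascPochhammer_add_eval, ascPochhammer_add_eval,
          show -ν + (m : ℂ) = m - ν by ring, show ν + 1 + (m : ℂ) = m + ν + 1 by ring,
          show 1 - (m : ℂ) + ((m + k : ℕ) : ℂ) = k + 1 by push_cast; ring,
          show 1 + (m : ℂ) + k = ((m + k : ℕ) : ℂ) + 1 by push_cast; ring,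
          Gamma_nat_eq_factorial, Gamma_nat_eq_factorial, pow_add,
          mul_assoc (w ^ m), ← ascPochhammer_eval_mul_eq_legendreCoeff]
      ring
  rw [(legendreHyp_spec ν m).eqOn hG hx']
  have : (-x) ^ m * (-1) ^ m = x ^ m := by rw [← mul_pow]; simp
  linear_combination (legendreCoeff m ν * F (-x)) * this

theorem IsHypContinuation.apply_zero {m : ℕ} {a b : ℂ} {F : ℂ → ℂ}
    (hF : IsHypContinuation a b (1 + m) F) : F 0 = 1 / m.factorial := by
  have h0 : (0 : ℂ) ∈ ball (0 : ℂ) 1 := by simp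
  have h := hasSum_regularizedGaussHGFun a b (1 + m) h0
  rw [← hF.2 h0] at h
  refine h.unique ?_
  have h1 := hasSum_single (f := fun k : ℕ => (ascPochhammer ℂ k).eval a *
    (ascPochhammer ℂ k).eval b / (k.factorial * Gamma (1 + m + k)) * 0 ^ k) 0 (by
      intro k hk; simp [hk])
  convert h1 using 1
  simp [add_comm (1 : ℂ), Gamma_nat_eq_factorial]

theorem digamma_natCast_add_one_add_one (k : ℕ) :
    digamma ((k + 1 : ℕ) + 1 : ℂ) = digamma (k + 1) + 1 / (k + 1) := by
  rw [one_div]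
  push_cast
  refine digamma_apply_add_one _ fun j hj => ?_
  have h1 : ((k + 1 + j : ℕ) : ℂ) = 0 := by
    push_cast
    linear_combination hj
  rw [Nat.cast_eq_zero] at h1
  omega

theorem legendreCoeff_succ (m : ℕ) (ν : ℂ) :
    legendreCoeff (m + 1) ν = legendreCoeff m ν * ((ν - m) * (ν + 1 + m)) :=
  Finset.prod_range_succ _ _

theorem legendreCoeff_natCast {n m : ℕ} (hmn : m ≤ n) :
    legendreCoeff m n = ((n + m).factorial : ℂ) / (n - m).factorial := by
  induction m with
  | zero => simp [legendreCoeff, Nat.factorial_ne_zero]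
  | succ m ih =>
    obtain ⟨j, rfl⟩ := Nat.exists_eq_add_of_le hmn
    rw [legendreCoeff_succ, ih (by omega), show m + 1 + j - m = j + 1 by omega,
      show m + 1 + j - (m + 1) = j by omega, ← add_assoc, Nat.factorial_succ (m + 1 + j + m),
      Nat.factorial_succ j]
    have h1 : (j.factorial : ℂ) ≠ 0 := by exact_mod_cast j.factorial_ne_zero
    have h2 : (j : ℂ) + 1 ≠ 0 := by exact_mod_cast j.succ_ne_zero
    push_cast
    field_simp
    ring

/-- Logarithmic differentiation: no factor vanishes at n since m ≤ n, and the sums of reciprocals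
telescope into digamma differences. -/
theorem hasDerivAt_legendreCoeff {n m : ℕ} (hmn : m ≤ n) :
    HasDerivAt (legendreCoeff m)
      (legendreCoeff m n * (digamma (n + m + 1) - digamma (n - m + 1))) n := by
  induction m with
  | zero =>
    have : legendreCoeff 0 = fun _ => 1 := by ext; simp [legendreCoeff]
    rw [this]
    exact (hasDerivAt_const _ _).congr_deriv (by simp)
  | succ m ih =>
    obtain ⟨j, rfl⟩ := Nat.exists_eq_add_of_le hmn
    have h1 : HasDerivAt (fun ν : ℂ => (ν - m) * (ν + 1 + m))
        (2 * ((m + 1 + j : ℕ) : ℂ) + 1) ((m + 1 + j : ℕ) : ℂ) := by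
      refine (((hasDerivAt_id ((m + 1 + j : ℕ) : ℂ)).sub_const (m : ℂ)).mul
        (((hasDerivAt_id ((m + 1 + j : ℕ) : ℂ)).add_const 1).add_const (m : ℂ))).congr_deriv ?_
      simp only [id]
      ring
    have h2 : legendreCoeff (m + 1) =
        legendreCoeff m * fun ν : ℂ => (ν - m) * (ν + 1 + m) := funext (legendreCoeff_succ m)
    rw [h2]
    refine ((ih (by omega)).mul h1).congr_deriv ?_
    have d1 := digamma_natCast_add_one_add_one (m + 1 + j + m)
    have d2 := digamma_natCast_add_one_add_one j
    rw [show ((m + 1 + j : ℕ) : ℂ) + ((m + 1 : ℕ) : ℂ) + 1 = ((m + 1 + j + m + 1 : ℕ) : ℂ) + 1 by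
      push_cast; ring, d1,
      show ((m + 1 + j : ℕ) : ℂ) - ((m + 1 : ℕ) : ℂ) + 1 = (j : ℂ) + 1 by push_cast; ring,
      show ((m + 1 + j : ℕ) : ℂ) - (m : ℂ) + 1 = ((j + 1 : ℕ) : ℂ) + 1 by push_cast; ring, d2,
      show ((m + 1 + j : ℕ) : ℂ) + (m : ℂ) + 1 = ((m + 1 + j + m : ℕ) : ℂ) + 1 by
      push_cast; ring]
    have e1 : (j : ℂ) + 1 ≠ 0 := by exact_mod_cast j.succ_ne_zero
    have e2 : ((m + 1 + j + m : ℕ) : ℂ) + 1 ≠ 0 := by exact_mod_cast (m + 1 + j + m).succ_ne_zero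
    have e3 : ((m + 1 + j : ℕ) : ℂ) - m = j + 1 := by push_cast; ring
    have e4 : ((m + 1 + j : ℕ) : ℂ) + 1 + m = ((m + 1 + j + m : ℕ) : ℂ) + 1 := by
      push_cast; ring
    have e5 : 2 * ((m + 1 + j : ℕ) : ℂ) + 1 = ((m + 1 + j + m : ℕ) : ℂ) + 1 + (j + 1) := by
      push_cast; ring
    simp only [Pi.mul_apply]
    rw [e3, e4, e5]
    field_simp
    ring

/-! ### Polynomial solutions and their digamma-weighted variants. -/

open Polynomial in
theorem Polynomial.eval_hypergeometric_ode {p e : ℂ[X]} {α β lam : ℂ}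
    (h : ∀ k : ℕ, (k + 1) * (k + α) * p.coeff (k + 1) +
      (k * (k - 1) + β * k - lam) * p.coeff k = e.coeff k) (x : ℂ) :
    x * (1 + x) * (derivative (derivative p)).eval x + (α + β * x) * (derivative p).eval x -
      lam * p.eval x = e.eval x := by
  have : X * (derivative (derivative p) + X * derivative (derivative p)) +
      (C α * derivative p + C β * (X * derivative p)) - C lam * p = e := by
    ext k
    rw [← h k]
    rcases k with _ | k
    · simp [coeff_derivative]
      ring
    · rcases k with _ | k
      · simp [coeff_derivative, coeff_X_mul]
        ring
      · simp [coeff_derivative, coeff_X_mul]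
        ring
  rw [← this]
  simp
  ring

/-- The coefficients `(k + N + l)! / (k! (k + m)! (N - k)!)`. -/
noncomputable def legendreTerm (N l m k : ℕ) : ℂ :=
  ((k + N + l).factorial : ℂ) / (k.factorial * (k + m).factorial * (N - k).factorial)

/-- The two-term recurrence of the hypergeometric equation. The choice N = n - m, l = 2m gives the
equation for f_n; N = n, l = 0 gives the one obtained after removing the factor (1 + x)^(-m). -/
theorem legendreTerm_succ {N l m k : ℕ} (hk : k < N) :
    (k + 1) * (k + m + 1) * legendreTerm N l m (k + 1) =
      (N - k) * (N + l + 1 + k) * legendreTerm N l m k := by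
  obtain ⟨j, rfl⟩ := Nat.exists_eq_add_of_lt hk
  simp only [legendreTerm]
  rw [show k + j + 1 - (k + 1) = j by omega, show k + j + 1 - k = j + 1 by omega,
    show k + 1 + (k + j + 1) + l = k + (k + j + 1) + l + 1 by ring,
    show k + 1 + m = k + m + 1 by ring, Nat.factorial_succ (k + (k + j + 1) + l),
    Nat.factorial_succ k, Nat.factorial_succ (k + m), Nat.factorial_succ j]
  have h1 : (j.factorial : ℂ) ≠ 0 := by exact_mod_cast j.factorial_ne_zero
  have h2 : (k.factorial : ℂ) ≠ 0 := by exact_mod_cast k.factorial_ne_zero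
  have h3 : ((k + m).factorial : ℂ) ≠ 0 := by exact_mod_cast (k + m).factorial_ne_zero
  have h4 : (j : ℂ) + 1 ≠ 0 := by exact_mod_cast j.succ_ne_zero
  have h5 : (k : ℂ) + 1 ≠ 0 := by exact_mod_cast k.succ_ne_zero
  have h6 : (k : ℂ) + m + 1 ≠ 0 := by exact_mod_cast (k + m).succ_ne_zero
  push_cast
  field_simp
  ring

open Polynomial in
/-- The polynomial `∑ₖ (k + N + l)! g(k) Xᵏ / (k! (k + m)! (N - k)!)`. -/
noncomputable def legendrePoly (N l m : ℕ) (g : ℕ → ℂ) : ℂ[X] :=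
  ∑ k ∈ Finset.range (N + 1), C (legendreTerm N l m k * g k) * X ^ k

theorem legendrePoly_coeff (N l m : ℕ) (g : ℕ → ℂ) (k : ℕ) :
    (legendrePoly N l m g).coeff k = if k ≤ N then legendreTerm N l m k * g k else 0 := by
  simp only [legendrePoly, Polynomial.finsetSum_coeff, Polynomial.coeff_C_mul_X_pow]
  simp

theorem legendrePoly_eval (N l m : ℕ) (g : ℕ → ℂ) (x : ℂ) :
    (legendrePoly N l m g).eval x =
      ∑ k ∈ Finset.range (N + 1), legendreTerm N l m k * g k * x ^ k := by
  simp [legendrePoly, Polynomial.eval_finsetSum]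

theorem legendrePoly_eval_zero (N l m : ℕ) (g : ℕ → ℂ) :
    (legendrePoly N l m g).eval 0 =
      ((N + l).factorial : ℂ) / (m.factorial * N.factorial) * g 0 := by
  rw [← Polynomial.coeff_zero_eq_eval_zero, legendrePoly_coeff]
  simp [legendreTerm]

-- By the recurrence the part of the coefficient proportional to g(k) cancels, so only the
-- increments g(k + 1) - g(k) reach the source.
open Polynomial in
theorem legendrePoly_ode {N l m : ℕ} {g : ℕ → ℂ} {e : ℂ[X]}
    (h : ∀ k < N, (k + 1) * (k + m + 1) * legendreTerm N l m (k + 1) * (g (k + 1) - g k) =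
      e.coeff k) (h' : ∀ k, N ≤ k → e.coeff k = 0) (x : ℂ) :
    x * (1 + x) * (derivative (derivative (legendrePoly N l m g))).eval x +
      (m + 1 + (l + 2) * x) * (derivative (legendrePoly N l m g)).eval x -
      N * (N + l + 1) * (legendrePoly N l m g).eval x = e.eval x := by
  refine Polynomial.eval_hypergeometric_ode (fun k => ?_) x
  simp only [legendrePoly_coeff]
  rcases lt_trichotomy k N with hk | rfl | hk
  · rw [if_pos (by omega), if_pos (by omega), ← h k hk]
    linear_combination g k * legendreTerm_succ (l := l) (m := m) hk
  -- The top coefficient is annihilated: N(N - 1) + (l + 2)N = N(N + l + 1).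
  · rw [if_neg (by omega), if_pos le_rfl, h' _ le_rfl]
    ring
  · rw [if_neg (by omega), if_neg (by omega), h' _ hk.le]
    ring

open Polynomial in
theorem legendrePoly_one_ode (N l m : ℕ) (x : ℂ) :
    x * (1 + x) * (derivative (derivative (legendrePoly N l m fun _ => 1))).eval x +
      (m + 1 + (l + 2) * x) * (derivative (legendrePoly N l m fun _ => 1)).eval x -
      N * (N + l + 1) * (legendrePoly N l m fun _ => 1).eval x = 0 := by
  rw [legendrePoly_ode (e := 0) (by simp) (by simp), eval_zero]

-- The increment 1/(k + m + 1) cancels one factor of the recurrence and leaves the coefficient of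
-- the derivative.
open Polynomial in
theorem legendrePoly_digamma_ode (N l m : ℕ) (x : ℂ) :
    x * (1 + x) *
        (derivative (derivative (legendrePoly N l m fun k => digamma (k + m + 1)))).eval x +
      (m + 1 + (l + 2) * x) *
        (derivative (legendrePoly N l m fun k => digamma (k + m + 1))).eval x -
      N * (N + l + 1) * (legendrePoly N l m fun k => digamma (k + m + 1)).eval x =
      (derivative (legendrePoly N l m fun _ => 1)).eval x := by
  refine legendrePoly_ode (fun k hk => ?_) (fun k hk => ?_) x
  · rw [coeff_derivative, legendrePoly_coeff, if_pos (by omega)]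
    have d := digamma_natCast_add_one_add_one (k + m)
    have h6 : (k : ℂ) + m + 1 ≠ 0 := by exact_mod_cast (k + m).succ_ne_zero
    rw [show ((k + 1 : ℕ) : ℂ) + m + 1 = ((k + m + 1 : ℕ) : ℂ) + 1 by push_cast; ring, d]
    push_cast
    field_simp
    ring
  · rw [coeff_derivative, legendrePoly_coeff, if_neg (by omega)]
    ring

-- With t_k the coefficients, the increment 2/(k + n + 1) turns the source coefficient (n - k)(n + k
-- + 1)t_k into 2(n - k)t_k, which is 2n - 2x d/dx; the increment -1/(k + m + 1) gives minus the
-- derivative.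
open Polynomial in
theorem legendrePoly_two_digamma_sub_ode (n m : ℕ) (x : ℂ) :
    x * (1 + x) * (derivative (derivative (legendrePoly n 0 m fun k =>
        2 * digamma (k + n + 1) - digamma (k + m + 1)))).eval x +
      (m + 1 + 2 * x) * (derivative (legendrePoly n 0 m fun k =>
        2 * digamma (k + n + 1) - digamma (k + m + 1))).eval x -
      n * (n + 1) * (legendrePoly n 0 m fun k =>
        2 * digamma (k + n + 1) - digamma (k + m + 1)).eval x =
      2 * n * (legendrePoly n 0 m fun _ => 1).eval x -
        (2 * x + 1) * (derivative (legendrePoly n 0 m fun _ => 1)).eval x := by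
  have h := legendrePoly_ode (N := n) (l := 0) (m := m)
    (g := fun k => 2 * digamma (k + n + 1) - digamma (k + m + 1))
    (e := C (2 * n : ℂ) * legendrePoly n 0 m (fun _ => 1) -
      (C 2 * (X * derivative (legendrePoly n 0 m fun _ => 1)) +
        derivative (legendrePoly n 0 m fun _ => 1))) ?_ ?_ x
  · simp only [eval_sub, eval_add, eval_mul, eval_C, eval_X, Nat.cast_zero, zero_add,
      add_zero] at h
    rw [h]
    ring
  · intro k hk
    have hX : (X * derivative (legendrePoly n 0 m fun _ => 1)).coeff k =
        k * legendreTerm n 0 m k := by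
      rcases k with _ | k
      · simp
      · rw [coeff_X_mul, coeff_derivative, legendrePoly_coeff, if_pos (by omega)]
        push_cast
        ring
    rw [coeff_sub, coeff_add, coeff_C_mul, coeff_C_mul, hX, coeff_derivative, legendrePoly_coeff,
      legendrePoly_coeff, if_pos (by omega), if_pos (by omega)]
    have d1 := digamma_natCast_add_one_add_one (k + m)
    have d2 := digamma_natCast_add_one_add_one (k + n)
    have h6 : (k : ℂ) + m + 1 ≠ 0 := by exact_mod_cast (k + m).succ_ne_zero
    have h7 : (k : ℂ) + n + 1 ≠ 0 := by exact_mod_cast (k + n).succ_ne_zero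
    rw [show ((k + 1 : ℕ) : ℂ) + m + 1 = ((k + m + 1 : ℕ) : ℂ) + 1 by push_cast; ring, d1,
      show ((k + 1 : ℕ) : ℂ) + n + 1 = ((k + n + 1 : ℕ) : ℂ) + 1 by push_cast; ring, d2]
    have hr := legendreTerm_succ (l := 0) (m := m) hk
    push_cast at hr ⊢
    field_simp
    linear_combination 2 * hr
  · intro k hk
    have hX : (X * derivative (legendrePoly n 0 m fun _ => 1)).coeff k =
        k * if k ≤ n then legendreTerm n 0 m k else 0 := by
      rcases k with _ | k
      · simp
      · rw [coeff_X_mul, coeff_derivative, legendrePoly_coeff]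
        push_cast
        simp only [mul_one]
        ring
    rw [coeff_sub, coeff_add, coeff_C_mul, coeff_C_mul, hX, coeff_derivative, legendrePoly_coeff,
      legendrePoly_coeff, if_neg (by omega : ¬ k + 1 ≤ n)]
    rcases hk.eq_or_lt with rfl | hk
    · simp
      ring
    · simp [hk.not_ge]

/-! ### Building blocks as solutions on the cut plane. -/

theorem Polynomial.isLegendreSol {m : ℕ} {lam : ℂ} {p : Polynomial ℂ} {h : ℂ → ℂ}
    (hp : ∀ x : ℂ, x * (1 + x) * (derivative (derivative p)).eval x +
      (m + 1) * (1 + 2 * x) * (derivative p).eval x - lam * p.eval x = h x) :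
    IsLegendreSol m lam h fun x => p.eval x :=
  ⟨_, _, fun x _ => ⟨p.hasDerivAt x, (derivative p).hasDerivAt x, hp x⟩⟩

/-- The terms still containing the logarithm cancel by the equation for p; the source is what the
product rule leaves over. -/
theorem Polynomial.isLegendreSol_mul_log {m : ℕ} {lam : ℂ} {p : Polynomial ℂ}
    (hp : ∀ x : ℂ, x * (1 + x) * (derivative (derivative p)).eval x +
      (m + 1) * (1 + 2 * x) * (derivative p).eval x - lam * p.eval x = 0) :
    IsLegendreSol m lam (fun x => 2 * x * (derivative p).eval x +
      (-x + (m + 1) * (1 + 2 * x)) / (1 + x) * p.eval x) fun x => p.eval x * log (1 + x) := by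
  refine ⟨fun x => (derivative p).eval x * log (1 + x) + p.eval x * (1 + x)⁻¹,
    fun x => (derivative (derivative p)).eval x * log (1 + x) +
      2 * ((derivative p).eval x * (1 + x)⁻¹) - p.eval x * ((1 + x) ^ 2)⁻¹, fun x hx => ?_⟩
  have hx0 := one_add_ne_zero_of_mem_legendreCutPlane hx
  have h1 : HasDerivAt (fun x : ℂ => 1 + x) 1 x := (hasDerivAt_id x).const_add 1
  have hl : HasDerivAt (fun x : ℂ => log (1 + x)) (1 + x)⁻¹ x := by
    simpa using h1.clog hx
  have hi : HasDerivAt (fun x : ℂ => (1 + x)⁻¹) (-((1 + x) ^ 2)⁻¹) x := by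
    refine (h1.inv hx0).congr_deriv ?_
    rw [neg_div, one_div]
  refine ⟨(p.hasDerivAt x).mul hl, ((((derivative p).hasDerivAt x).mul hl).add
    ((p.hasDerivAt x).mul hi)).congr_deriv (by ring), ?_⟩
  have := hp x
  field_simp
  linear_combination (log (1 + x) * (1 + x)) * this

/-- Euler's transformation at the level of the equation: the exponents at x = -1 are 0 and -m, and
the factor (1 + x)^(-m) exchanges them. -/
theorem Polynomial.isLegendreSol_div_pow {n m : ℕ} {p : Polynomial ℂ} {e : ℂ → ℂ}
    (hp : ∀ x : ℂ, x * (1 + x) * (derivative (derivative p)).eval x +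
      (m + 1 + 2 * x) * (derivative p).eval x - n * (n + 1) * p.eval x = e x) :
    IsLegendreSol m ((n - m) * (n + m + 1)) (fun x => e x * ((1 + x) ^ m)⁻¹)
      fun x => p.eval x * ((1 + x) ^ m)⁻¹ := by
  refine ⟨fun x => ((derivative p).eval x - m * (p.eval x * (1 + x)⁻¹)) * ((1 + x) ^ m)⁻¹,
    fun x => ((derivative (derivative p)).eval x - 2 * m * ((derivative p).eval x * (1 + x)⁻¹) +
      m * (m + 1) * (p.eval x * ((1 + x) ^ 2)⁻¹)) * ((1 + x) ^ m)⁻¹, fun x hx => ?_⟩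
  have hx0 := one_add_ne_zero_of_mem_legendreCutPlane hx
  have h1 : HasDerivAt (fun x : ℂ => 1 + x) 1 x := (hasDerivAt_id x).const_add 1
  have hi : HasDerivAt (fun x : ℂ => (1 + x)⁻¹) (-((1 + x) ^ 2)⁻¹) x := by
    refine (h1.inv hx0).congr_deriv ?_
    rw [neg_div, one_div]
  have hv : HasDerivAt (fun x : ℂ => ((1 + x) ^ m)⁻¹)
      (-(m * (1 + x)⁻¹ * ((1 + x) ^ m)⁻¹)) x := by
    refine ((h1.pow m).inv (pow_ne_zero m hx0)).congr_deriv ?_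
    rcases m with _ | m
    · simp
    · simp only [Nat.add_sub_cancel, Pi.pow_apply]
      field_simp
      ring
  refine ⟨((p.hasDerivAt x).mul hv).congr_deriv (by ring),
    ((((derivative p).hasDerivAt x).sub (((p.hasDerivAt x).mul hi).const_mul (m : ℂ))).mul
      hv).congr_deriv ?_, ?_⟩
  · simp only [Pi.mul_apply, Pi.sub_apply]
    rw [← inv_pow (1 + x) 2]
    ring
  · beta_reduce
    rw [← hp x]
    generalize ((1 + x) ^ m)⁻¹ = v
    field_simp
    ring

theorem legendrePoly_isLegendreSol {n m : ℕ} (hmn : m ≤ n) {g : ℕ → ℂ} {h : ℂ → ℂ}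
    (hp : ∀ x : ℂ, x * (1 + x) * (Polynomial.derivative (Polynomial.derivative
        (legendrePoly (n - m) (2 * m) m g))).eval x +
      (m + 1 + ((2 * m : ℕ) + 2) * x) *
        (Polynomial.derivative (legendrePoly (n - m) (2 * m) m g)).eval x -
      (n - m : ℕ) * ((n - m : ℕ) + (2 * m : ℕ) + 1) *
        (legendrePoly (n - m) (2 * m) m g).eval x = h x) (x : ℂ) :
    x * (1 + x) * (Polynomial.derivative (Polynomial.derivative
        (legendrePoly (n - m) (2 * m) m g))).eval x +
      (m + 1) * (1 + 2 * x) *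
        (Polynomial.derivative (legendrePoly (n - m) (2 * m) m g)).eval x -
      (n - m) * (n + m + 1) * (legendrePoly (n - m) (2 * m) m g).eval x = h x := by
  rw [← hp x, Nat.cast_sub hmn]
  push_cast
  ring

/-- `(1 + x)ᵐ ∑ₖ (k + n + m)! xᵏ / (k! (k + m)! (n - m - k)!)` equals
`(n + m)! / (n - m)! ∑ₖ (k + n)! xᵏ / (k! (k + m)! (n - k)!)`. -/
theorem legendrePoly_eval_eq {n m : ℕ} (hmn : m ≤ n) {x : ℂ} (hx : x ∈ legendreCutPlane) :
    (legendrePoly (n - m) (2 * m) m fun _ => 1).eval x =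
      ((n + m).factorial : ℂ) / (n - m).factorial *
        ((legendrePoly n 0 m fun _ => 1).eval x * ((1 + x) ^ m)⁻¹) := by
  have h1 := Polynomial.isLegendreSol
    (legendrePoly_isLegendreSol hmn (legendrePoly_one_ode (n - m) (2 * m) m))
  have h2 := (Polynomial.isLegendreSol_div_pow (n := n) (m := m)
    (p := legendrePoly n 0 m fun _ => 1) (e := fun _ => 0) (fun y => by
      simpa using legendrePoly_one_ode n 0 m y)).const_mul
    (((n + m).factorial : ℂ) / (n - m).factorial)
  refine h1.eqOn (h2.congr_right fun y _ => by ring) ?_ hx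
  rw [legendrePoly_eval_zero, legendrePoly_eval_zero, show n - m + 2 * m = n + m by omega]
  have e1 : (n.factorial : ℂ) ≠ 0 := by exact_mod_cast n.factorial_ne_zero
  simp only [add_zero, one_pow, inv_one, mul_one]
  field_simp

/-! ### The closed form solves the differentiated equation. -/

/-- The derivative of the regular factor of the Legendre function with respect to the degree. -/
noncomputable def legendreDegreeDeriv (n m : ℕ) (x : ℂ) : ℂ :=
  (legendrePoly (n - m) (2 * m) m fun _ => 1).eval x * log (1 + x) +
    (digamma (n + m + 1) - 2 * digamma (n + 1) - digamma (n - m + 1)) *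
      (legendrePoly (n - m) (2 * m) m fun _ => 1).eval x +
    (legendrePoly (n - m) (2 * m) m fun k => digamma (k + m + 1)).eval x +
    ((n + m).factorial : ℂ) / (n - m).factorial *
      ((legendrePoly n 0 m fun k => 2 * digamma (k + n + 1) - digamma (k + m + 1)).eval x *
        ((1 + x) ^ m)⁻¹)

/-- Let p be the polynomial solution, written as C q (1 + x)^(-m). The logarithmic and digamma terms
contribute (1 + 2x)p', the last term -(1 + 2x)C q'(1 + x)^(-m) + 2n p. The difference of derivatives
is a multiple of p/(1 + x), which combines with the rest of the logarithmic source to give (2n +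
1)p. -/
theorem isLegendreSol_legendreDegreeDeriv {n m : ℕ} (hmn : m ≤ n) :
    IsLegendreSol m ((n - m) * (n + m + 1))
      (fun x => (2 * n + 1) * (legendrePoly (n - m) (2 * m) m fun _ => 1).eval x)
      (legendreDegreeDeriv n m) := by
  have hp := legendrePoly_isLegendreSol hmn (legendrePoly_one_ode (n - m) (2 * m) m)
  have h1 := Polynomial.isLegendreSol_mul_log hp
  have h2 := (Polynomial.isLegendreSol hp).const_mul
    (digamma (n + m + 1) - 2 * digamma (n + 1) - digamma (n - m + 1))
  have h3 := Polynomial.isLegendreSol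
    (legendrePoly_isLegendreSol hmn (legendrePoly_digamma_ode (n - m) (2 * m) m))
  have h4 := (Polynomial.isLegendreSol_div_pow
    (legendrePoly_two_digamma_sub_ode n m)).const_mul (((n + m).factorial : ℂ) / (n - m).factorial)
  refine (((h1.add h2).add h3).add h4).congr_right fun x hx => ?_
  have hx0 := one_add_ne_zero_of_mem_legendreCutPlane hx
  have hd : (Polynomial.derivative (legendrePoly (n - m) (2 * m) m fun _ => 1)).eval x =
      ((n + m).factorial : ℂ) / (n - m).factorial *
        (((Polynomial.derivative (legendrePoly n 0 m fun _ => 1)).eval x -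
          m * ((legendrePoly n 0 m fun _ => 1).eval x * (1 + x)⁻¹)) * ((1 + x) ^ m)⁻¹) := by
    have e1 : HasDerivAt (fun x : ℂ => 1 + x) 1 x := (hasDerivAt_id x).const_add 1
    have e2 : HasDerivAt (fun x : ℂ => ((1 + x) ^ m)⁻¹)
        (-(m * (1 + x)⁻¹ * ((1 + x) ^ m)⁻¹)) x := by
      refine ((e1.pow m).inv (pow_ne_zero m hx0)).congr_deriv ?_
      rcases m with _ | m
      · simp
      · simp only [Nat.add_sub_cancel, Pi.pow_apply]
        field_simp
        ring
    have e3 := (((legendrePoly n 0 m fun _ => 1).hasDerivAt x).mul e2).const_mul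
      (((n + m).factorial : ℂ) / (n - m).factorial)
    have hopen : IsOpen legendreCutPlane :=
      isOpen_slitPlane.preimage (by fun_prop : Continuous fun x : ℂ => 1 + x)
    -- Differentiates the identity p = C q (1 + x)^(-m), which holds on a neighbourhood of x.
    have e4 := ((legendrePoly (n - m) (2 * m) m fun _ => 1).hasDerivAt x).congr_of_eventuallyEq
      (f₁ := fun x => ((n + m).factorial : ℂ) / (n - m).factorial *
        ((legendrePoly n 0 m fun _ => 1).eval x * ((1 + x) ^ m)⁻¹)) (by
        filter_upwards [hopen.mem_nhds hx] with y hy using (legendrePoly_eval_eq hmn hy).symm)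
    refine (e4.unique e3).trans ?_
    ring
  rw [hd, legendrePoly_eval_eq hmn hx]
  generalize ((1 + x) ^ m)⁻¹ = v
  generalize ((n + m).factorial : ℂ) / (n - m).factorial = C
  field_simp
  ring

/-- The terms in ψ(n + 1) and ψ(m + 1) cancel between the summands; this fixes the constant multiple
of the homogeneous solution. -/
theorem legendreDegreeDeriv_zero {n m : ℕ} (hmn : m ≤ n) :
    legendreDegreeDeriv n m 0 = legendreCoeff m n *
      (digamma (n + m + 1) - digamma (n - m + 1)) * (1 / m.factorial) := by
  have e1 : (n.factorial : ℂ) ≠ 0 := by exact_mod_cast n.factorial_ne_zero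
  simp only [legendreDegreeDeriv, legendrePoly_eval_zero, legendreCoeff_natCast hmn,
    show n - m + 2 * m = n + m by omega, add_zero, log_one, one_pow, inv_one, Nat.cast_zero,
    zero_add]
  field_simp
  ring

/-! ### Assembly and return to the variable z. -/

theorem hasDerivAt_legendreHyp {n m : ℕ} (hmn : m ≤ n) {x : ℂ} (hx : x ∈ legendreCutPlane) :
    HasDerivAt (fun ν => legendreHyp ν m (-x)) (x ^ m * legendreDegreeDeriv n m x) n ∧
      legendreHyp n m (-x) = x ^ m * (legendrePoly (n - m) (2 * m) m fun _ => 1).eval x := by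
  -- The half-plane Re ν > -1 is a neighbourhood of n on which the second parameter has positive
  -- real part. A separate choice for each ν suffices, and outside the half-plane the value 0 is
  -- never used.
  have hex : ∀ ν : ℂ, ∃ F, 0 < ν.re + 1 →
      IsHypContinuation (m - ν) (m + ν + 1) (1 + m) F := by
    intro ν
    by_cases h : 0 < ν.re + 1
    · obtain ⟨F, hF⟩ := exists_isHypContinuation_of_re_pos (m - ν) (b := m + ν + 1) (1 + m) (by
        simp only [add_re, natCast_re, one_re]
        have : (0 : ℝ) ≤ m := Nat.cast_nonneg m
        linarith)
      exact ⟨F, fun _ => hF⟩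
    · exact ⟨0, fun h' => absurd h' h⟩
  choose F hF using hex
  have hev : ∀ᶠ ν in nhds (n : ℂ), 0 < ν.re + 1 := by
    have hc : Continuous fun ν : ℂ => ν.re + 1 := by fun_prop
    refine (isOpen_lt continuous_const hc).mem_nhds ?_
    simp only [mem_ofPred_eq, natCast_re]
    positivity
  set f : ℂ → ℂ → ℂ := fun ν x => legendreCoeff m ν * F ν (-x) with hf
  have hsol : ∀ ν : ℂ, 0 < ν.re + 1 →
      IsLegendreSol m ((ν - m) * (ν + m + 1)) (fun _ => 0) (f ν) := fun ν hν =>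
    ((hF ν hν).isLegendreSol.const_mul _).congr_right fun _ _ => mul_zero _
  have hval : ∀ ν : ℂ, 0 < ν.re + 1 → f ν 0 = legendreCoeff m ν * (1 / m.factorial) := by
    intro ν hν
    simp only [hf, neg_zero, (hF ν hν).apply_zero]
  have hn : 0 < (n : ℂ).re + 1 := hev.self_of_nhds
  have hfn : EqOn (f n) (fun x => (legendrePoly (n - m) (2 * m) m fun _ => 1).eval x)
      legendreCutPlane := by
    refine (hsol n hn).eqOn (Polynomial.isLegendreSol
      (legendrePoly_isLegendreSol hmn (legendrePoly_one_ode (n - m) (2 * m) m))) ?_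
    rw [hval n hn, legendrePoly_eval_zero, legendreCoeff_natCast hmn,
      show n - m + 2 * m = n + m by omega]
    field_simp
  have hd : HasDerivAt (fun ν => f ν x) (legendreDegreeDeriv n m x) n := by
    refine hasDerivAt_isLegendreSol (m := m) (lam := fun ν => (ν - m) * (ν + m + 1))
      (fun ν => by ring) (hev.mono hsol) ?_ ?_ hx
    · exact (isLegendreSol_legendreDegreeDeriv hmn).congr_right fun y hy => by
        rw [hfn hy]
    · rw [legendreDegreeDeriv_zero hmn]
      refine ((hasDerivAt_legendreCoeff hmn).mul_const (1 / (m.factorial : ℂ))).congr_of_eventuallyEq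
        ?_
      exact hev.mono hval
  refine ⟨(hd.const_mul (x ^ m)).congr_of_eventuallyEq ?_, ?_⟩
  · exact hev.mono fun ν hν => legendreHyp_natCast_eq (hF ν hν) hx
  · rw [legendreHyp_natCast_eq (hF n hn) hx]
    exact congrArg (x ^ m * ·) (hfn hx)

theorem two_mul_cpow (x s : ℂ) : (2 * x) ^ s = 2 ^ s * x ^ s := by
  rcases eq_or_ne x 0 with rfl | hx
  · rcases eq_or_ne s 0 with rfl | hs
    · simp
    · simp [zero_cpow hs]
  · rw [cpow_def_of_ne_zero (mul_ne_zero two_ne_zero hx), cpow_def_of_ne_zero two_ne_zero,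
      cpow_def_of_ne_zero hx, ← exp_add, ← add_mul]
    congr 2
    have := log_ofReal_mul (r := 2) two_pos hx
    rw [Complex.ofReal_ofNat] at this
    rw [this, ofNat_log]

theorem mainTheorem6 (n m : ℕ) (hmn : m ≤ n) (z : ℂ) (hz : z - 1 ∈ slitPlane) :
    HasDerivAt (fun ν : ℂ => assocLegendreP ν m z)
      (assocLegendreP n m z * log ((z + 1) / 2)
        + (digamma (n + m + 1) - 2 * digamma (n + 1) - digamma (n - m + 1)) *
            assocLegendreP n m z
        + ((z - 1) / 2) ^ ((m : ℂ) / 2) * ((z + 1) / 2) ^ ((m : ℂ) / 2) *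
            ∑ k ∈ Finset.range (n - m + 1),
              ((k + n + m).factorial : ℂ) * digamma (k + m + 1) /
                (k.factorial * (k + m).factorial * (n - m - k).factorial) *
                ((z - 1) / 2) ^ k
        + ((n + m).factorial : ℂ) / (n - m).factorial *
            ((z - 1) ^ ((m : ℂ) / 2) / (z + 1) ^ ((m : ℂ) / 2)) *
            ∑ k ∈ Finset.range (n + 1),
              ((k + n).factorial : ℂ) /
                (k.factorial * (k + m).factorial * (n - k).factorial) *
                (2 * digamma (k + n + 1) - digamma (k + m + 1)) *
                ((z - 1) / 2) ^ k)
      (n : ℂ) := by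
  obtain ⟨x, rfl⟩ : ∃ x, z = 2 * x + 1 := ⟨(z - 1) / 2, by ring⟩
  have hx' : x ∈ slitPlane := by
    rw [mem_slitPlane_iff] at hz ⊢
    simpa using hz
  have hx : x ∈ legendreCutPlane := by
    rw [legendreCutPlane, mem_ofPred_eq]
    rw [mem_slitPlane_iff] at hx' ⊢
    simp only [add_re, one_re, add_im, one_im, zero_add]
    exact hx'.imp (fun h => by linarith) id
  have hx0 : x ≠ 0 := slitPlane_ne_zero hx'
  have hx1 : 1 + x ≠ 0 := one_add_ne_zero_of_mem_legendreCutPlane hx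
  obtain ⟨hd, hv⟩ := hasDerivAt_legendreHyp hmn hx
  rw [show (2 * x + 1 + 1) / 2 = 1 + x by ring, show (2 * x + 1 - 1) / 2 = x by ring]
  simp only [assocLegendreP]
  rw [show 2 * x + 1 + 1 = 2 * (1 + x) by ring, show 2 * x + 1 - 1 = 2 * x by ring,
    show (1 - (2 * x + 1)) / 2 = -x by ring, hv, two_mul_cpow, two_mul_cpow]
  have h2 : (2 : ℂ) ^ ((m : ℂ) / 2) ≠ 0 := by simp [cpow_eq_zero_iff]
  have hp0 : x ^ ((m : ℂ) / 2) ≠ 0 := by simp [cpow_eq_zero_iff, hx0]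
  have hq0 : (1 + x) ^ ((m : ℂ) / 2) ≠ 0 := by simp [cpow_eq_zero_iff, hx1]
  -- Splitting x^m and (1 + x)^m into two equal principal powers turns the prefactor ((1 +
  -- x)/x)^(m/2) x^m into the two prefactors of the formula; the powers of 2 cancel.
  have hp2 : x ^ m = x ^ ((m : ℂ) / 2) * x ^ ((m : ℂ) / 2) := by
    rw [← cpow_add _ _ hx0, add_halves, cpow_natCast]
  have hq2 : (1 + x) ^ m = (1 + x) ^ ((m : ℂ) / 2) * (1 + x) ^ ((m : ℂ) / 2) := by
    rw [← cpow_add _ _ hx1, add_halves, cpow_natCast]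
  refine (hd.const_mul _).congr_deriv ?_
  have hs1 : ∑ k ∈ Finset.range (n - m + 1), ((k + n + m).factorial : ℂ) * digamma (k + m + 1) /
      (k.factorial * (k + m).factorial * (n - m - k).factorial) * x ^ k =
      (legendrePoly (n - m) (2 * m) m fun k => digamma (k + m + 1)).eval x := by
    rw [legendrePoly_eval]
    refine Finset.sum_congr rfl fun k _ => ?_
    rw [legendreTerm, show k + (n - m) + 2 * m = k + n + m by omega]
    ring
  have hs2 : ∑ k ∈ Finset.range (n + 1), ((k + n).factorial : ℂ) /
      (k.factorial * (k + m).factorial * (n - k).factorial) *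
      (2 * digamma (k + n + 1) - digamma (k + m + 1)) * x ^ k =
      (legendrePoly n 0 m fun k => 2 * digamma (k + n + 1) - digamma (k + m + 1)).eval x := by
    rw [legendrePoly_eval]
    rfl
  rw [hs1, hs2, legendreDegreeDeriv, hp2, hq2]
  field_simp
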